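/- Let $V$ be a three-dimensional complex vector space with its usual topology, and consider Lie algebras $\mathfrak g=(V,[\cdot,\cdot])$ with underlying space $V$. A \emph{(one-parametric continuous) contraction} from $\mathfrak g$ to $\mathfrak g_0=(V,[\cdot,\cdot]_0)$ is a continuous function $U\colon(0,1]\to GL(V)$ such that $\lim_{\varepsilon\to+0}U_\varepsilon^{-1}[U_\varepsilon x,U_\varepsilon y]=[x,y]_0$ for all $x,y\in V$. It is \emph{proper} if $\mathfrak g_0\not\cong\mathfrak g$, and \emph{direct} if there is no $\mathfrak g_1$ with $\mathfrak g_1\not\cong\mathfrak g$, $\mathfrak g_1\not\cong\mathfrak g_0$ such that $\mathfrak g$ is contracted to $\mathfrak g_1$ and $\mathfrak g_1$ is contracted to $\mathfrak g_0$. Contractions from $\mathfrak g$ to $\mathfrak g_0$ and from $\tilde{\mathfrak g}$ to $\tilde{\mathfrak g}_0$ are \emph{equivalent} if $\mathfrak g\cong\tilde{\mathfrak g}$ and $\mathfrak g_0\cong\tilde{\mathfrak g}_0$. A contraction is a \emph{simple Inönü–Wigner contraction} if for constant bases $v_1,v_2,v_3$ and $w_1,w_2,w_3$ of $V$ and some $0\le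 s\le 3$ one has, for all $\varepsilon\in(0,1]$, $U_\varepsilon v_i=w_i$ for $i\le s$ and $U_\varepsilon v_i=\varepsilon w_i$ for $i>s$. Let the following complex Lie algebras be given by their nonzero commutators up to antisymmetry: - $3\mathfrak g_1$: Abelian; - $\mathfrak g_{2.1}\oplus\mathfrak g_1$: $[e_1,e_2]=e_1$; - $\mathfrak g_{3.1}$: $[e_2,e_3]=e_1$; - $\mathfrak g_{3.2}$: $[e_1,e_3]=e_1$, $[e_2,e_3]=e_1+e_2$; - $\mathfrak g_{3.3}$: $[e_1,e_3]=e_1$, $[e_2,e_3]=e_2$; - $\mathfrak g_{3.4}^\alpha$, $\alpha\in\mathbb C\setminus\{0,1\}$: $[e_1,e_3]=e_1$, $[e_2,e_3]=\alpha e_2$; - $sl(2,\mathbb C)$: $[e_1,e_2]=e_1$, $[e_2,e_3]=e_3$, $[e_1,e_3]=2e_2$. **Theorem.** 1. Any continuous contraction of complex three-dimensional Lie algebras is equivalent to a simple Inönü–Wigner contraction. 2. Every complex three-dimensional Lie algebra is isomorphic to one of the algebras listed above, and these are pairwise nonisomorphic except that $\mathfrak g_{3.4}^\alpha\cong\mathfrak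 g_{3.4}^\beta$ if (and, for $\alpha\neq\beta$, only if) $\alpha\beta=1$. 3. Up to isomorphism, the pairs of algebras between which there is a direct proper contraction are exactly $$sl(2,\mathbb C)\to\mathfrak g_{3.4}^{-1},\quad \mathfrak g_{3.4}^{\alpha}\to\mathfrak g_{3.1}\ (\alpha\in\mathbb C\setminus\{0,1\}),\quad \mathfrak g_{2.1}\oplus\mathfrak g_1\to\mathfrak g_{3.1},\quad \mathfrak g_{3.2}\to\mathfrak g_{3.1},\quad \mathfrak g_{3.2}\to\mathfrak g_{3.3},\quad \mathfrak g_{3.1}\to3\mathfrak g_1,\quad \mathfrak g_{3.3}\to3\mathfrak g_1.$$ 4. A proper contraction from one of the listed algebras to another exists (up to isomorphism) if and only if there is a nonempty directed path of these arrows from the first to the second. -/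

import Mathlib

open Filter Topology

/-- A complex Lie algebra `(V, [·,·])` with underlying vector space `V`, i.e. a Lie bracket on `V`:
a bilinear, alternating map satisfying the Jacobi identity. -/
structure LieStructure (V : Type*) [AddCommGroup V] [Module ℂ V] where
  bracket : V →ₗ[ℂ] V →ₗ[ℂ] V
  alternating : ∀ x, bracket x x = 0
  jacobi : ∀ x y z,
    bracket x (bracket y z) + bracket y (bracket z x) + bracket z (bracket x y) = 0

namespace LieStructure

section Carrier

variable {V : Type*} [AddCommGroup V] [Module ℂ V]

theorem skew (μ : LieStructure V) (x y : V) : μ.bracket x y = - μ.bracket y x := by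
  have h := μ.alternating (x + y)
  simp only [map_add, LinearMap.add_apply, μ.alternating, zero_add, add_zero] at h
  exact eq_neg_of_add_eq_zero_right h

/-- The vector space `V`, regarded as a Lie algebra with the Lie bracket `μ`. -/
def Carrier (_μ : LieStructure V) : Type _ := V

instance (μ : LieStructure V) : AddCommGroup μ.Carrier := inferInstanceAs (AddCommGroup V)

instance (μ : LieStructure V) : Module ℂ μ.Carrier := inferInstanceAs (Module ℂ V)

instance (μ : LieStructure V) : LieRing μ.Carrier where
  bracket x y := μ.bracket (x : V) (y : V)
  add_lie x y z := μ.bracket.map_add₂ x y z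
  lie_add x y z := (μ.bracket x).map_add y z
  lie_self x := μ.alternating x
  leibniz_lie x y z := by
    have h := μ.jacobi (x : V) y z
    have h1 : μ.bracket (μ.bracket (x : V) y) z = - μ.bracket z (μ.bracket (x : V) y) := μ.skew _ _
    have h2 : μ.bracket (y : V) (μ.bracket z x) = - μ.bracket y (μ.bracket x z) := by
      rw [μ.skew z x, map_neg]
    change μ.bracket (x : V) (μ.bracket y z)
      = μ.bracket (μ.bracket (x : V) y) z + μ.bracket (y : V) (μ.bracket x z)
    rw [h2] at h
    rw [h1]
    have := eq_neg_of_add_eq_zero_left h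
    have h3 := eq_sub_of_add_eq this
    rw [h3]
    abel

instance (μ : LieStructure V) : LieAlgebra ℂ μ.Carrier where
  lie_smul t x y := (μ.bracket x).map_smul t y

end Carrier

/-- Isomorphism of the Lie algebras `(V, μ)` and `(W, ν)`. -/
def Isomorphic {V W : Type*} [AddCommGroup V] [Module ℂ V] [AddCommGroup W] [Module ℂ W]
    (μ : LieStructure V) (ν : LieStructure W) : Prop :=
  Nonempty (μ.Carrier ≃ₗ⁅ℂ⁆ ν.Carrier)

end LieStructure

/-- A one-parametric continuous contraction from the Lie algebra `(V, source)` to the Lie algebra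
`(V, target)`: a continuous function `U : (0,1] → GL(V)` (values of `U` outside `(0,1]` are
irrelevant) such that `U_ε⁻¹ [U_ε x, U_ε y]` tends to `[x, y]₀` as `ε → +0`, for all `x, y`.
Over a finite-dimensional space, continuity of `U` for the topology of `GL(V)` is continuity of
`ε ↦ U_ε x` for every `x`. -/
structure LieContraction (V : Type*) [AddCommGroup V] [Module ℂ V] [TopologicalSpace V] where
  source : LieStructure V
  target : LieStructure V
  U : ℝ → V ≃ₗ[ℂ] V
  continuousOn_U : ∀ x, ContinuousOn (fun ε => U ε x) (Set.Ioc 0 1)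
  tendsto_bracket : ∀ x y,
    Tendsto (fun ε => (U ε).symm (source.bracket (U ε x) (U ε y))) (𝓝[>] 0)
      (𝓝 (target.bracket x y))

namespace LieContraction

variable {V : Type*} [AddCommGroup V] [Module ℂ V] [TopologicalSpace V]

/-- (Weak) equivalence of contractions: isomorphic sources and isomorphic targets. -/
def Equivalent (C D : LieContraction V) : Prop :=
  C.source.Isomorphic D.source ∧ C.target.Isomorphic D.target

/-- A simple Inönü–Wigner contraction: in suitable constant bases of the two copies of `V`, the
matrix of `U_ε` is `diag(1, …, 1, ε, …, ε)` for all `ε ∈ (0,1]`, where `1` occurs `s` times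
(`0 ≤ s ≤ dim V`). -/
def IsSimpleInonuWigner (C : LieContraction V) : Prop :=
  ∃ (v w : Module.Basis (Fin (Module.finrank ℂ V)) ℂ V) (s : ℕ), s ≤ Module.finrank ℂ V ∧
    ∀ ε ∈ Set.Ioc (0 : ℝ) 1, ∀ i : Fin (Module.finrank ℂ V),
      C.U ε (v i) = (if (i : ℕ) < s then (1 : ℂ) else (ε : ℂ)) • w i

end LieContraction

namespace LieStructure

variable {V : Type*} [AddCommGroup V] [Module ℂ V] [TopologicalSpace V]

/-- `(V, μ)` is contracted to `(V, μ₀)`. -/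
def ContractsTo (μ μ₀ : LieStructure V) : Prop :=
  ∃ C : LieContraction V, C.source = μ ∧ C.target = μ₀

/-- `(V, μ)` is properly contracted to `(V, μ₀)`: the two algebras are not isomorphic. -/
def ProperlyContractsTo (μ μ₀ : LieStructure V) : Prop :=
  μ.ContractsTo μ₀ ∧ ¬ μ₀.Isomorphic μ

/-- There is a direct proper contraction from `(V, μ)` to `(V, μ₀)`: a proper contraction for which
no algebra `μ₁`, isomorphic neither to `μ` nor to `μ₀`, lies in between. -/
def DirectlyContractsTo (μ μ₀ : LieStructure V) : Prop :=
  μ.ProperlyContractsTo μ₀ ∧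
    ¬ ∃ μ₁ : LieStructure V, ¬ μ₁.Isomorphic μ ∧ ¬ μ₁.Isomorphic μ₀ ∧
      μ.ContractsTo μ₁ ∧ μ₁.ContractsTo μ₀

end LieStructure

/-- The bilinear map on `ℂ³` with `[e₁,e₂] = a`, `[e₁,e₃] = b`, `[e₂,e₃] = c`, extended by
antisymmetry; `eᵢ` is the standard basis (`eᵢ` has index `i - 1` in `Fin 3`). -/
def bracketOfCommutators (a b c : Fin 3 → ℂ) :
    (Fin 3 → ℂ) →ₗ[ℂ] (Fin 3 → ℂ) →ₗ[ℂ] (Fin 3 → ℂ) :=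
  LinearMap.mk₂ ℂ
    (fun x y => (x 0 * y 1 - x 1 * y 0) • a + (x 0 * y 2 - x 2 * y 0) • b
      + (x 1 * y 2 - x 2 * y 1) • c)
    (by intros; ext; simp; ring) (by intros; ext; simp; ring)
    (by intros; ext; simp; ring) (by intros; ext; simp; ring)

/-- The nodes of the contraction diagram of complex three-dimensional Lie algebras. -/
inductive LieNode : Type
  | abelian : LieNode
  | g21_g1 : LieNode
  | g31 : LieNode
  | g32 : LieNode
  | g33 : LieNode
  | g34 (α : ℂ) (h0 : α ≠ 0) (h1 : α ≠ 1) : LieNode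
  | sl2 : LieNode

namespace LieNode

/-- The commutators `([e₁,e₂], [e₁,e₃], [e₂,e₃])` of the algebra at a node. -/
def commutators : LieNode → (Fin 3 → ℂ) × (Fin 3 → ℂ) × (Fin 3 → ℂ)
  | abelian => (0, 0, 0)
  | g21_g1 => (![1, 0, 0], 0, 0)
  | g31 => (0, 0, ![1, 0, 0])
  | g32 => (0, ![1, 0, 0], ![1, 1, 0])
  | g33 => (0, ![1, 0, 0], ![0, 1, 0])
  | g34 α _ _ => (0, ![1, 0, 0], ![0, α, 0])
  | sl2 => (![1, 0, 0], ![0, 2, 0], ![0, 0, 1])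

/-- The Lie algebra on `ℂ³` at a node. -/
def algebra (n : LieNode) : LieStructure (Fin 3 → ℂ) where
  bracket := bracketOfCommutators n.commutators.1 n.commutators.2.1 n.commutators.2.2
  alternating x := by
    ext i
    simp [bracketOfCommutators, mul_comm]
  jacobi x y z := by
    cases n <;> ext i <;> fin_cases i <;> simp [bracketOfCommutators, commutators] <;> ring

/-- The coincidences between nodes: `g34 α` and `g34 β` denote the same node if `α β = 1`. -/
def Same (m n : LieNode) : Prop :=
  m = n ∨ ∃ (α β : ℂ) (hα0 : α ≠ 0) (hα1 : α ≠ 1) (hβ0 : β ≠ 0) (hβ1 : β ≠ 1),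
    m = g34 α hα0 hα1 ∧ n = g34 β hβ0 hβ1 ∧ α * β = 1

/-- The arrows of the contraction diagram. -/
inductive Arrow : LieNode → LieNode → Prop
  | sl2_g34 (h0 : (-1 : ℂ) ≠ 0) (h1 : (-1 : ℂ) ≠ 1) : Arrow sl2 (g34 (-1) h0 h1)
  | g34_g31 (α : ℂ) (h0 : α ≠ 0) (h1 : α ≠ 1) : Arrow (g34 α h0 h1) g31
  | g21_g1_g31 : Arrow g21_g1 g31
  | g32_g31 : Arrow g32 g31
  | g32_g33 : Arrow g32 g33
  | g33_abelian : Arrow g33 abelian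
  | g31_abelian : Arrow g31 abelian

end LieNode

/-! Classification rests on the linear form tr ad, which vanishes on brackets. If it is nonzero, its
kernel is a two-dimensional ideal, which turns out to be Abelian, and a vector outside it acts
triangularly. If it is zero, either some ad x has a nonzero eigenvalue, so its spectrum is 0, a, -a
and the algebra is sl(2) or triangular, or all ad x are nilpotent and Engel's theorem supplies a
central vector. Triangular algebras are sorted by `exists_isomorphic_of_triangular`.

A contraction presents the target as a limit of algebras isomorphic to the source, so every
isomorphism-invariant closed condition on brackets survives it. The conditions used are polynomial
identities, together with a fixed ratio between (tr ad x)² and tr (ad x)², which determines the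
eigenvalue ratio α up to inversion (`of_adTraceSq_relation`). They leave only the pairs joined by a
path (`reaches_of_contractsTo`). Nonisomorphism of the listed algebras comes for free: an
isomorphism is a contraction in both directions, while paths strictly lower the level.

Conversely, each arrow is realized by scaling some vectors of a suitable basis by ε. The only
composite paths run from sl(2) to `g31` or end at the Abelian algebra (`eq_of_transGen`), and these
too are realized in one step, so contractions never have to be composed. -/

open Module

/-! ### Isomorphisms, transported brackets and commutators in a basis -/

namespace LieStructure

section Transport

variable {V W X : Type*} [AddCommGroup V] [Module ℂ V] [AddCommGroup W] [Module ℂ W]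
  [AddCommGroup X] [Module ℂ X]

theorem isomorphic_iff {μ : LieStructure V} {ν : LieStructure W} :
    μ.Isomorphic ν ↔
      ∃ φ : V ≃ₗ[ℂ] W, ∀ x y, φ (μ.bracket x y) = ν.bracket (φ x) (φ y) := by
  constructor
  · rintro ⟨e⟩
    exact ⟨e.toLinearEquiv, fun x y => LieHom.map_lie e.toLieHom x y⟩
  · rintro ⟨φ, h⟩
    let φ' : μ.Carrier ≃ₗ[ℂ] ν.Carrier := φ
    exact ⟨{ φ' with map_lie' := fun {x y} => h x y }⟩

theorem Isomorphic.refl (μ : LieStructure V) : μ.Isomorphic μ := ⟨LieEquiv.refl⟩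

theorem Isomorphic.symm {μ : LieStructure V} {ν : LieStructure W} (h : μ.Isomorphic ν) :
    ν.Isomorphic μ := h.map LieEquiv.symm

theorem Isomorphic.trans {μ : LieStructure V} {ν : LieStructure W} {ρ : LieStructure X}
    (h : μ.Isomorphic ν) (h' : ν.Isomorphic ρ) : μ.Isomorphic ρ :=
  h.elim fun e => h'.map e.trans

/-- The Lie bracket on `V` obtained from one on `W` along a linear equivalence. -/
def pullback (φ : V ≃ₗ[ℂ] W) (ν : LieStructure W) : LieStructure V where
  bracket := (ν.bracket.compl₁₂ φ.toLinearMap φ.toLinearMap).compr₂ φ.symm.toLinearMap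
  alternating x := by simp [ν.alternating]
  jacobi x y z := by
    have h := ν.jacobi (φ x) (φ y) (φ z)
    simp only [LinearMap.compr₂_apply, LinearMap.compl₁₂_apply, LinearEquiv.coe_coe,
      LinearEquiv.apply_symm_apply, ← map_add, h, map_zero]

theorem pullback_bracket (φ : V ≃ₗ[ℂ] W) (ν : LieStructure W) (x y : V) :
    (ν.pullback φ).bracket x y = φ.symm (ν.bracket (φ x) (φ y)) := rfl

theorem pullback_isomorphic (φ : V ≃ₗ[ℂ] W) (ν : LieStructure W) :
    (ν.pullback φ).Isomorphic ν :=
  isomorphic_iff.2 ⟨φ, fun x y => by simp [pullback_bracket]⟩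

/-- Two Lie brackets with the same commutators of basis vectors are isomorphic. -/
theorem isomorphic_of_basis {μ : LieStructure V} {ν : LieStructure W}
    (b : Basis (Fin 3) ℂ V) (c : Basis (Fin 3) ℂ W)
    (h01 : b.equiv c (Equiv.refl _) (μ.bracket (b 0) (b 1)) = ν.bracket (c 0) (c 1))
    (h02 : b.equiv c (Equiv.refl _) (μ.bracket (b 0) (b 2)) = ν.bracket (c 0) (c 2))
    (h12 : b.equiv c (Equiv.refl _) (μ.bracket (b 1) (b 2)) = ν.bracket (c 1) (c 2)) :
    μ.Isomorphic ν := by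
  refine isomorphic_iff.2 ⟨b.equiv c (Equiv.refl _), fun x y => ?_⟩
  have key : μ.bracket.compr₂ (b.equiv c (Equiv.refl _)).toLinearMap =
      ν.bracket.compl₁₂ (b.equiv c (Equiv.refl _)).toLinearMap
        (b.equiv c (Equiv.refl _)).toLinearMap := by
    refine b.ext fun i => b.ext fun j => ?_
    simp only [LinearMap.compr₂_apply, LinearMap.compl₁₂_apply, LinearEquiv.coe_coe,
      Basis.equiv_apply, Equiv.refl_apply]
    fin_cases i <;> fin_cases j <;>
      simp only [Fin.zero_eta, Fin.mk_one, Fin.reduceFinMk, μ.alternating, ν.alternating,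
        map_zero, h01, h02, h12]
    · rw [μ.skew, ν.skew, map_neg, h01]
    · rw [μ.skew, ν.skew, map_neg, h02]
    · rw [μ.skew, ν.skew, map_neg, h12]
  exact congrArg (fun B => B x y) key

end Transport

end LieStructure

theorem bracketOfCommutators_apply (a b c x y : Fin 3 → ℂ) :
    bracketOfCommutators a b c x y = (x 0 * y 1 - x 1 * y 0) • a + (x 0 * y 2 - x 2 * y 0) • b
      + (x 1 * y 2 - x 2 * y 1) • c := rfl

namespace LieNode

variable {V : Type*} [AddCommGroup V] [Module ℂ V]

theorem bracket_algebra (n : LieNode) (x y : Fin 3 → ℂ) : n.algebra.bracket x y =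
    bracketOfCommutators n.commutators.1 n.commutators.2.1 n.commutators.2.2 x y := rfl

theorem isomorphic_algebra {μ : LieStructure V} (n : LieNode) (b : Basis (Fin 3) ℂ V)
    (h01 : μ.bracket (b 0) (b 1) = ∑ i, n.commutators.1 i • b i)
    (h02 : μ.bracket (b 0) (b 2) = ∑ i, n.commutators.2.1 i • b i)
    (h12 : μ.bracket (b 1) (b 2) = ∑ i, n.commutators.2.2 i • b i) :
    μ.Isomorphic n.algebra := by
  have key (v : Fin 3 → ℂ) :
      b.equiv (Pi.basisFun ℂ (Fin 3)) (Equiv.refl _) (∑ i, v i • b i) = v := by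
    ext j
    simp [map_sum, Basis.equiv_apply, Pi.single_apply]
  refine LieStructure.isomorphic_of_basis b (Pi.basisFun ℂ (Fin 3)) ?_ ?_ ?_ <;>
    simp [h01, h02, h12, key, bracket_algebra, bracketOfCommutators_apply]

end LieNode

/-! ### Linear algebra -/

theorem exists_basis_of_three {V : Type*} [AddCommGroup V] [Module ℂ V] (hV : finrank ℂ V = 3)
    (x y z : V) (h : ∀ a b c : ℂ, a • x + b • y + c • z = 0 → a = 0 ∧ b = 0 ∧ c = 0) :
    ∃ b : Basis (Fin 3) ℂ V, b 0 = x ∧ b 1 = y ∧ b 2 = z := by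
  have hli : LinearIndependent ℂ ![x, y, z] := by
    refine Fintype.linearIndependent_iff.2 fun g hg => ?_
    simp only [Fin.sum_univ_three, Matrix.cons_val] at hg
    obtain ⟨h0, h1, h2⟩ := h _ _ _ hg
    intro i
    fin_cases i <;> assumption
  refine ⟨basisOfLinearIndependentOfCardEqFinrank hli (by simp [hV]), ?_⟩
  simp

theorem Module.Basis.eq_sum_three {V : Type*} [AddCommGroup V] [Module ℂ V]
    (b : Basis (Fin 3) ℂ V) (x : V) :
    x = b.repr x 0 • b 0 + b.repr x 1 • b 1 + b.repr x 2 • b 2 := by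
  conv_lhs => rw [← b.sum_repr x, Fin.sum_univ_three]

theorem LinearMap.trace_eq_sum_repr {V : Type*} [AddCommGroup V] [Module ℂ V]
    (b : Basis (Fin 3) ℂ V) (f : V →ₗ[ℂ] V) : LinearMap.trace ℂ V f = ∑ i, b.repr (f (b i)) i := by
  rw [LinearMap.trace_eq_matrix_trace ℂ b, Matrix.trace]
  simp [LinearMap.toMatrix_apply]

/-- Over ℂ the characteristic polynomial splits, so if all its roots are zero it is a power of X,
which forces nilpotency. -/
theorem Module.End.exists_hasEigenvalue_ne_zero {V : Type*} [AddCommGroup V] [Module ℂ V]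
    [FiniteDimensional ℂ V] {f : End ℂ V} (hf : ¬ IsNilpotent f) :
    ∃ a : ℂ, a ≠ 0 ∧ f.HasEigenvalue a := by
  by_contra! hc
  refine hf (LinearMap.isNilpotent_iff_charpoly f |>.2 ?_)
  have hs := IsAlgClosed.splits (LinearMap.charpoly f)
  have hr : (LinearMap.charpoly f).roots = Multiset.replicate (finrank ℂ V) 0 := by
    refine Multiset.eq_replicate.2 ⟨?_, fun a ha => ?_⟩
    · rw [← hs.natDegree_eq_card_roots, LinearMap.charpoly_natDegree]
    · by_contra h0
      exact hc a h0 (Module.End.hasEigenvalue_iff_isRoot_charpoly f a |>.2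
        (Polynomial.isRoot_of_mem_roots ha))
  rw [hs.eq_prod_roots_of_monic (LinearMap.charpoly_monic f), hr]
  simp

/-! ### Classification in dimension three -/

namespace LieStructure

variable {V : Type*} [AddCommGroup V] [Module ℂ V]

/-- The trace of `ad x`, as a linear form. -/
noncomputable def adTrace (μ : LieStructure V) : V →ₗ[ℂ] ℂ := LinearMap.trace ℂ V ∘ₗ μ.bracket

/-- The Killing form on the diagonal, `x ↦ tr (ad x)²`. -/
noncomputable def adTraceSq (μ : LieStructure V) (x : V) : ℂ :=
  LinearMap.trace ℂ V (μ.bracket x ∘ₗ μ.bracket x)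

theorem adTrace_eq_sum (μ : LieStructure V) (b : Basis (Fin 3) ℂ V) (x : V) :
    μ.adTrace x = ∑ i, b.repr (μ.bracket x (b i)) i := LinearMap.trace_eq_sum_repr b _

theorem adTraceSq_eq_sum (μ : LieStructure V) (b : Basis (Fin 3) ℂ V) (x : V) :
    μ.adTraceSq x = ∑ i, b.repr (μ.bracket x (μ.bracket x (b i))) i :=
  LinearMap.trace_eq_sum_repr b _

/-- By Jacobi, ad [x, y] is the commutator of ad x and ad y. -/
theorem adTrace_bracket (μ : LieStructure V) (x y : V) : μ.adTrace (μ.bracket x y) = 0 := by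
  have h : μ.bracket (μ.bracket x y) =
      μ.bracket x * μ.bracket y - μ.bracket y * μ.bracket x := by
    ext z
    have h := μ.jacobi x y z
    rw [μ.skew z x, μ.skew z, map_neg] at h
    simp only [LinearMap.sub_apply, Module.End.mul_apply]
    have h' := eq_neg_of_add_eq_zero_left h
    rw [neg_neg, ← sub_eq_add_neg] at h'
    exact h'.symm
  rw [adTrace, LinearMap.comp_apply, h, map_sub, LinearMap.trace_mul_comm, sub_self]

/-- A basis in which the first two vectors span an Abelian ideal on which the third acts by a
triangular matrix. -/
theorem exists_isomorphic_of_triangular (μ : LieStructure V) (hV : finrank ℂ V = 3)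
    (b : Basis (Fin 3) ℂ V) (p c q : ℂ) (h01 : μ.bracket (b 0) (b 1) = 0)
    (h02 : μ.bracket (b 0) (b 2) = p • b 0)
    (h12 : μ.bracket (b 1) (b 2) = c • b 0 + q • b 1) :
    ∃ n : LieNode, μ.Isomorphic n.algebra := by
  have hli : ∀ r s t : ℂ, r • b 0 + s • b 1 + t • b 2 = 0 → r = 0 ∧ s = 0 ∧ t = 0 := by
    intro r s t h
    have := Fintype.linearIndependent_iff.1 b.linearIndependent ![r, s, t]
      (by simpa [Fin.sum_univ_three] using h)
    exact ⟨this 0, this 1, this 2⟩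
  -- a diagonal action with first eigenvalue nonzero
  have diag : ∀ (x y : V) (p q : ℂ), p ≠ 0 → p ≠ q →
      (∀ r s t : ℂ, r • x + s • y + t • b 2 = 0 → r = 0 ∧ s = 0 ∧ t = 0) →
      μ.bracket x y = 0 → μ.bracket x (b 2) = p • x → μ.bracket y (b 2) = q • y →
      ∃ n : LieNode, μ.Isomorphic n.algebra := by
    intro x y p q hp hpq hxy h1 h2 h3
    by_cases hq : q = 0
    · obtain ⟨v, v0, v1, v2⟩ := exists_basis_of_three hV x (p⁻¹ • b 2) y (by
        intro r s t h
        obtain ⟨h0, h1, h2⟩ := hxy r t (s * p⁻¹) (by rw [← h]; module)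
        exact ⟨h0, by simpa [hp] using h2, h1⟩)
      refine ⟨.g21_g1, LieNode.isomorphic_algebra _ v ?_ ?_ ?_⟩ <;>
        simp [LieNode.commutators, Fin.sum_univ_three, v0, v1, v2, h1, h2, h3, hp, hq, μ.skew (b 2)]
    · obtain ⟨v, v0, v1, v2⟩ := exists_basis_of_three hV x y (p⁻¹ • b 2) (by
        intro r s t h
        obtain ⟨h0, h1, h2⟩ := hxy r s (t * p⁻¹) (by rw [← h]; module)
        exact ⟨h0, h1, by simpa [hp] using h2⟩)
      refine ⟨.g34 (p⁻¹ * q) (by simp [hp, hq]) (fun h => hpq ?_),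
        LieNode.isomorphic_algebra _ v ?_ ?_ ?_⟩
      · field_simp at h
        exact h.symm
      all_goals
        simp [LieNode.commutators, Fin.sum_univ_three, v0, v1, v2, h1, h2, h3, hp, smul_smul]
  by_cases hpq : p = q
  · subst hpq
    by_cases hp : p = 0
    · subst hp
      by_cases hc : c = 0
      · subst hc
        exact ⟨.abelian, LieNode.isomorphic_algebra _ b (by simp [LieNode.commutators, h01])
          (by simp [LieNode.commutators, h02]) (by simp [LieNode.commutators, h12])⟩
      · obtain ⟨v, v0, v1, v2⟩ := exists_basis_of_three hV (c • b 0) (b 1) (b 2) (by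
          intro r s t h
          obtain ⟨h0, h1, h2⟩ := hli (r * c) s t (by rw [← h]; module)
          exact ⟨by simpa [hc] using h0, h1, h2⟩)
        refine ⟨.g31, LieNode.isomorphic_algebra _ v ?_ ?_ ?_⟩ <;>
          simp [LieNode.commutators, Fin.sum_univ_three, v0, v1, v2, h01, h02, h12]
    · by_cases hc : c = 0
      · subst hc
        obtain ⟨v, v0, v1, v2⟩ := exists_basis_of_three hV (b 0) (b 1) (p⁻¹ • b 2) (by
          intro r s t h
          obtain ⟨h0, h1, h2⟩ := hli r s (t * p⁻¹) (by rw [← h]; module)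
          exact ⟨h0, h1, by simpa [hp] using h2⟩)
        refine ⟨.g33, LieNode.isomorphic_algebra _ v ?_ ?_ ?_⟩ <;>
          simp [LieNode.commutators, Fin.sum_univ_three, v0, v1, v2, h01, h02, h12, hp]
      -- Dividing the third vector by p makes the eigenvalue 1; the factor p⁻¹c on the first absorbs
      -- the remaining off-diagonal entry.
      · obtain ⟨v, v0, v1, v2⟩ := exists_basis_of_three hV ((p⁻¹ * c) • b 0) (b 1) (p⁻¹ • b 2) (by
          intro r s t h
          obtain ⟨h0, h1, h2⟩ := hli (r * (p⁻¹ * c)) s (t * p⁻¹) (by rw [← h]; module)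
          exact ⟨by simpa [hp, hc] using h0, h1, by simpa [hp] using h2⟩)
        refine ⟨.g32, LieNode.isomorphic_algebra _ v ?_ ?_ ?_⟩ <;>
          simp [LieNode.commutators, Fin.sum_univ_three, v0, v1, v2, h01, h02, h12, hp, smul_smul,
            mul_comm]
  · have hqp : q - p ≠ 0 := sub_ne_zero.2 (Ne.symm hpq)
    -- Distinct eigenvalues: the action is diagonalizable, and this combination is the eigenvector
    -- for q.
    have h01' : μ.bracket (b 0) (b 1 + (c / (q - p)) • b 0) = 0 := by
      simp [h01, μ.alternating]
    have h12' : μ.bracket (b 1 + (c / (q - p)) • b 0) (b 2) =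
        q • (b 1 + (c / (q - p)) • b 0) := by
      simp only [map_add, map_smul, LinearMap.add_apply, LinearMap.smul_apply, h12, h02]
      match_scalars
      · field_simp
        ring
      · ring
    by_cases hp : p = 0
    · refine diag (b 1 + (c / (q - p)) • b 0) (b 0) q p (by rintro rfl; exact hpq hp)
        (Ne.symm hpq) ?_ (by rw [μ.skew, h01', neg_zero]) h12' h02
      intro r s t h
      obtain ⟨h0, h1, h2⟩ := hli (s + r * (c / (q - p))) r t (by rw [← h]; module)
      subst h1
      exact ⟨rfl, by simpa using h0, h2⟩
    · refine diag (b 0) (b 1 + (c / (q - p)) • b 0) p q hp hpq ?_ h01' h02 h12'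
      intro r s t h
      obtain ⟨h0, h1, h2⟩ := hli (r + s * (c / (q - p))) s t (by rw [← h]; module)
      subst h1
      exact ⟨by simpa using h0, rfl, h2⟩

/-- The kernel K of tr ad contains all brackets. Take z outside K, an eigenvector u of [·, z] in K,
and w completing u to a basis of K. Vanishing of tr ad u and tr ad w kills both coordinates of [u,
w], so K is Abelian and z acts on it triangularly. -/
theorem exists_isomorphic_of_adTrace_ne_zero (μ : LieStructure V) (hV : finrank ℂ V = 3)
    (h : μ.adTrace ≠ 0) : ∃ n : LieNode, μ.Isomorphic n.algebra := by
  have : FiniteDimensional ℂ V := FiniteDimensional.of_finrank_pos (by omega)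
  obtain ⟨z, hz⟩ : ∃ z, μ.adTrace z ≠ 0 := by
    by_contra! h0
    exact h (LinearMap.ext h0)
  set K := LinearMap.ker μ.adTrace with hK
  have hKrank : finrank ℂ K = 2 := by
    have h1 := LinearMap.finrank_range_add_finrank_ker μ.adTrace
    rw [LinearMap.range_eq_top.2 (LinearMap.surjective h), finrank_top, Module.finrank_self, hV]
      at h1
    rw [← hK] at h1
    omega
  have hmaps : ∀ x ∈ K, (μ.bracket.flip z) x ∈ K := fun x _ => μ.adTrace_bracket x z
  have : Nontrivial K := Module.nontrivial_of_finrank_pos (R := ℂ) (by omega)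
  obtain ⟨p, hp⟩ := Module.End.exists_eigenvalue ((μ.bracket.flip z).restrict hmaps)
  obtain ⟨u, hu⟩ := hp.exists_hasEigenvector
  have hu0 : (u : V) ≠ 0 := fun h => hu.2 (Subtype.ext h)
  have huz : μ.bracket u z = p • (u : V) := congrArg Subtype.val hu.apply_eq_smul
  obtain ⟨w, hw⟩ : ∃ w : K, w ∉ Submodule.span ℂ {u} := by
    by_contra! hc
    have h1 : Submodule.span ℂ {u} = ⊤ := by
      rw [eq_top_iff]
      exact fun w _ => hc w
    have h2 := finrank_span_singleton (K := ℂ) hu.2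
    rw [h1, finrank_top] at h2
    omega
  have hfu : μ.adTrace u = 0 := u.2
  have hfw : μ.adTrace w = 0 := w.2
  obtain ⟨b, b0, b1, b2⟩ := exists_basis_of_three hV (u : V) w z (by
    intro r s t h
    have ht : t = 0 := by
      have := congrArg μ.adTrace h
      simpa [hfu, hfw, hz] using this
    subst ht
    have hs : s = 0 := by
      by_contra hs
      refine hw (Submodule.mem_span_singleton.2 ⟨-(s⁻¹ * r), Subtype.ext ?_⟩)
      have h2 : s • (w : V) = -(r • (u : V)) := by
        rw [zero_smul, add_zero, add_comm] at h
        exact eq_neg_of_add_eq_zero_left h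
      have h3 := congrArg (fun v => s⁻¹ • v) h2
      simp only [smul_smul, inv_mul_cancel₀ hs, one_smul, smul_neg] at h3
      simp [h3]
    subst hs
    simpa [hu0] using h)
  have coord : ∀ x, μ.adTrace x = 0 → b.repr x 2 = 0 := by
    intro x hx
    rw [b.eq_sum_three x] at hx
    simpa [b0, b1, b2, hfu, hfw, hz] using hx
  have e01 := b.eq_sum_three (μ.bracket (b 0) (b 1))
  have e12 := b.eq_sum_three (μ.bracket (b 1) (b 2))
  rw [coord _ (μ.adTrace_bracket _ _), zero_smul, add_zero] at e01 e12
  have e02 : μ.bracket (b 0) (b 2) = p • b 0 := by rw [b0, b2, huz]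
  have t0 := μ.adTrace_eq_sum b (b 0)
  have t1 := μ.adTrace_eq_sum b (b 1)
  rw [b0, hfu, ← b0, Fin.sum_univ_three, μ.alternating, e02] at t0
  rw [b1, hfw, ← b1, Fin.sum_univ_three, μ.alternating, coord _ (μ.adTrace_bracket _ _),
    μ.skew] at t1
  have t0' : b.repr (μ.bracket (b 0) (b 1)) 1 = 0 := by simpa using t0.symm
  have t1' : b.repr (μ.bracket (b 0) (b 1)) 0 = 0 := by simpa using t1.symm
  rw [t0', t1', zero_smul, zero_smul, add_zero] at e01
  exact μ.exists_isomorphic_of_triangular hV b _ _ _ e01 e02 e12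

/-- Since ad x kills x, has an eigenvalue a ≠ 0 and has trace zero, its eigenvalues 0, a, -a are
distinct and it has an eigenbasis x, y, z. Vanishing of tr ad y and tr ad z leaves [y, z] = d x.
Here d = 0 is a triangular case and d ≠ 0 gives sl(2). -/
theorem exists_isomorphic_of_not_isNilpotent (μ : LieStructure V) (hV : finrank ℂ V = 3)
    (h : μ.adTrace = 0) (x : V) (hx : ¬ IsNilpotent (μ.bracket x : Module.End ℂ V)) :
    ∃ n : LieNode, μ.Isomorphic n.algebra := by
  have : FiniteDimensional ℂ V := FiniteDimensional.of_finrank_pos (by omega)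
  obtain ⟨a, ha, hy⟩ := Module.End.exists_hasEigenvalue_ne_zero hx
  obtain ⟨y, hy⟩ := hy.exists_hasEigenvector
  have hxy : μ.bracket x y = a • y := hy.apply_eq_smul
  have hx0 : x ≠ 0 := by
    rintro rfl
    simp at hx
  have hli : LinearIndependent ℂ ![x, y] := by
    refine LinearIndependent.pair_iff.2 fun s t hst => ?_
    have h1 := congrArg (μ.bracket x) hst
    have ht : t = 0 := by simpa [μ.alternating, hxy, ha, hy.2] using h1
    subst ht
    simpa [hx0] using hst
  obtain ⟨w, hw⟩ : ∃ w : V, w ∉ Submodule.span ℂ (Set.range ![x, y]) := by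
    by_contra! hc
    have h1 : Submodule.span ℂ (Set.range ![x, y]) = ⊤ := by
      rw [eq_top_iff]
      exact fun w _ => hc w
    have h2 := finrank_span_eq_card hli
    rw [h1, finrank_top] at h2
    simp at h2
    omega
  have hli' : ∀ r s t : ℂ, r • x + s • y + t • w = 0 → r = 0 ∧ s = 0 ∧ t = 0 := by
    intro r s t h
    have ht : t = 0 := by
      by_contra ht
      refine hw ?_
      rw [Matrix.range_cons, Matrix.range_cons, Matrix.range_empty, Set.union_empty,
        Set.singleton_union, Submodule.mem_span_pair]
      refine ⟨-(t⁻¹ * r), -(t⁻¹ * s), ?_⟩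
      have h3 := congrArg (fun v => t⁻¹ • v) h
      simp only [smul_add, smul_smul, inv_mul_cancel₀ ht, one_smul, smul_zero] at h3
      rw [eq_neg_of_add_eq_zero_right h3]
      module
    subst ht
    rw [zero_smul, add_zero] at h
    have := LinearIndependent.pair_iff.1 hli r s h
    exact ⟨this.1, this.2, rfl⟩
  obtain ⟨b, b0, b1, b2⟩ := exists_basis_of_three hV x y w hli'
  have trace0 : ∀ (b : Basis (Fin 3) ℂ V) v, ∑ i, b.repr (μ.bracket v (b i)) i = 0 := by
    intro b v
    rw [← μ.adTrace_eq_sum, h, LinearMap.zero_apply]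
  have e02 := b.eq_sum_three (μ.bracket (b 0) (b 2))
  have t0 : b.repr (μ.bracket (b 0) (b 2)) 2 = -a := by
    have := trace0 b (b 0)
    rw [Fin.sum_univ_three, μ.alternating, b0, b1, hxy, ← b0, ← b1] at this
    simp at this
    linear_combination this
  rw [t0] at e02
  generalize b.repr (μ.bracket (b 0) (b 2)) 0 = k at e02
  generalize b.repr (μ.bracket (b 0) (b 2)) 1 = l at e02
  rw [b0, b1, b2] at e02
  -- The coefficients solve [x, z] = -a z, given [x, w] = k x + l y - a w.
  set z := w + (-k / a) • x + (-l / (2 * a)) • y with hz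
  have hxz : μ.bracket x z = (-a) • z := by
    rw [hz]
    simp only [map_add, map_smul, e02, hxy, μ.alternating]
    match_scalars <;> field_simp
    ring
  have hliz : ∀ r s t : ℂ, r • x + s • y + t • z = 0 → r = 0 ∧ s = 0 ∧ t = 0 := by
    intro r s t h
    obtain ⟨h0, h1, h2⟩ := hli' (r + t * (-k / a)) (s + t * (-l / (2 * a))) t
      (by rw [← h, hz]; module)
    subst h2
    exact ⟨by simpa using h0, by simpa using h1, rfl⟩
  obtain ⟨v, v0, v1, v2⟩ := exists_basis_of_three hV x y z hliz
  have e12 := v.eq_sum_three (μ.bracket (v 1) (v 2))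
  have hyx : μ.bracket y x = (-a) • y := by rw [μ.skew, hxy, neg_smul]
  have hzx : μ.bracket z x = a • z := by rw [μ.skew, hxz, neg_smul, neg_neg]
  have t1 : v.repr (μ.bracket (v 1) (v 2)) 2 = 0 := by
    have := trace0 v (v 1)
    rw [Fin.sum_univ_three, μ.alternating, v0, v1, hyx, ← v1] at this
    simpa using this
  have t2 : v.repr (μ.bracket (v 1) (v 2)) 1 = 0 := by
    have := trace0 v (v 2)
    rw [Fin.sum_univ_three, μ.alternating, v0, v2, hzx, ← v2, μ.skew (v 2) (v 1)] at this
    simpa using this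
  rw [t1, t2, zero_smul, zero_smul, add_zero, add_zero, v0, v1, v2] at e12
  generalize v.repr (μ.bracket y z) 0 = d at e12
  by_cases hd : d = 0
  · subst hd
    obtain ⟨v, v0, v1, v2⟩ := exists_basis_of_three hV y z x (by
      intro r s t h
      obtain ⟨h0, h1, h2⟩ := hliz t r s (by rw [← h]; module)
      exact ⟨h1, h2, h0⟩)
    exact μ.exists_isomorphic_of_triangular hV v (-a) 0 a (by rw [v0, v1, e12, zero_smul])
      (by rw [v0, v2, hyx]) (by rw [v0, v1, v2, hzx, zero_smul, zero_add])
  -- With e₂ = -a⁻¹ x and e₃ = z, the relation [e₁, e₃] = 2 e₂ forces this multiple of y as e₁.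
  · have hm : -2 / (d * a) ≠ 0 := by simp [hd, ha]
    obtain ⟨v, v0, v1, v2⟩ := exists_basis_of_three hV ((-2 / (d * a)) • y) ((-a⁻¹) • x) z (by
      intro r s t h
      obtain ⟨h0, h1, h2⟩ := hliz (s * (-a⁻¹)) (r * (-2 / (d * a))) t (by rw [← h]; module)
      exact ⟨(mul_eq_zero_iff_right hm).1 h1, by simpa [ha] using h0, h2⟩)
    refine ⟨.sl2, LieNode.isomorphic_algebra _ v ?_ ?_ ?_⟩ <;>
      simp only [LieNode.commutators, Fin.sum_univ_three, v0, v1, v2, map_smul,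
        LinearMap.smul_apply, hyx, hxz, e12, Matrix.cons_val, zero_smul, add_zero, zero_add] <;>
      match_scalars <;> field_simp

/-- Engel's theorem gives a nonzero central vector z. In a basis starting with z, the trace
conditions on the other two vectors place their commutator on the line of z, so the algebra is
triangular with zero eigenvalues. -/
theorem exists_isomorphic_of_isNilpotent (μ : LieStructure V) (hV : finrank ℂ V = 3)
    (h : μ.adTrace = 0) (hn : ∀ x, IsNilpotent (μ.bracket x : Module.End ℂ V)) :
    ∃ n : LieNode, μ.Isomorphic n.algebra := by
  have : FiniteDimensional ℂ V := FiniteDimensional.of_finrank_pos (by omega)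
  have : Nontrivial V := Module.nontrivial_of_finrank_pos (R := ℂ) (by omega)
  obtain ⟨z, hz0, hz⟩ : ∃ z : V, z ≠ 0 ∧ ∀ x, μ.bracket x z = 0 := by
    have : FiniteDimensional ℂ μ.Carrier := inferInstanceAs (FiniteDimensional ℂ V)
    have : Nontrivial μ.Carrier := inferInstanceAs (Nontrivial V)
    have : LieRing.IsNilpotent μ.Carrier :=
      (LieAlgebra.isNilpotent_iff_forall (R := ℂ) (L := μ.Carrier)).2 hn
    have := LieModule.nontrivial_max_triv_of_isNilpotent ℂ μ.Carrier μ.Carrier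
    obtain ⟨z, hz⟩ := exists_ne (0 : LieModule.maxTrivSubmodule ℂ μ.Carrier μ.Carrier)
    exact ⟨z.1, fun h => hz (Subtype.ext h),
      (LieModule.mem_maxTrivSubmodule ℂ μ.Carrier μ.Carrier z.1).1 z.2⟩
  obtain ⟨b, hb⟩ : ∃ b : Basis (Fin 3) ℂ V, b 0 = z := by
    have hli : LinearIndepOn ℂ id {z} := by simpa using hz0
    let B := Basis.extend hli
    have hmem : z ∈ hli.extend (Set.subset_univ _) := hli.subset_extend _ rfl
    have : Fintype (hli.extend (Set.subset_univ {z})) := FiniteDimensional.fintypeBasisIndex B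
    have hcard : Fintype.card (hli.extend (Set.subset_univ {z})) = 3 := by
      rw [← Module.finrank_eq_card_basis B, hV]
    let e := Fintype.equivFinOfCardEq hcard
    refine ⟨B.reindex (e.trans (Equiv.swap (e ⟨z, hmem⟩) 0)), ?_⟩
    simp [B, Equiv.swap_apply_right]
  have hz' : ∀ x, μ.bracket z x = 0 := fun x => by rw [μ.skew, hz, neg_zero]
  have e12 := b.eq_sum_three (μ.bracket (b 1) (b 2))
  have trace0 : ∀ v, ∑ i, b.repr (μ.bracket v (b i)) i = 0 := by
    intro v
    rw [← μ.adTrace_eq_sum, h, LinearMap.zero_apply]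
  have t1 : b.repr (μ.bracket (b 1) (b 2)) 2 = 0 := by
    have := trace0 (b 1)
    rw [Fin.sum_univ_three, μ.alternating, hb, hz] at this
    simpa using this
  have t2 : b.repr (μ.bracket (b 1) (b 2)) 1 = 0 := by
    have := trace0 (b 2)
    rw [Fin.sum_univ_three, μ.alternating, hb, hz, μ.skew] at this
    simpa using this
  rw [t1, t2, zero_smul, zero_smul] at e12
  generalize b.repr (μ.bracket (b 1) (b 2)) 0 = d at e12
  exact μ.exists_isomorphic_of_triangular hV b 0 d 0 (by rw [hb, hz']) (by rw [hb, hz', zero_smul])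
    (by rw [e12, zero_smul, add_zero])

/-- Classification of complex three-dimensional Lie algebras. -/
theorem exists_isomorphic_algebra (μ : LieStructure V) (hV : finrank ℂ V = 3) :
    ∃ n : LieNode, μ.Isomorphic n.algebra := by
  by_cases h : μ.adTrace = 0
  · by_cases hn : ∀ x, IsNilpotent (μ.bracket x : Module.End ℂ V)
    · exact μ.exists_isomorphic_of_isNilpotent hV h hn
    · obtain ⟨x, hx⟩ := not_forall.1 hn
      exact μ.exists_isomorphic_of_not_isNilpotent hV h x hx
  · exact μ.exists_isomorphic_of_adTrace_ne_zero hV h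

end LieStructure

/-! ### Invariants that survive contraction -/

namespace LieStructure

section Pullback

variable {V W : Type*} [AddCommGroup V] [Module ℂ V] [AddCommGroup W] [Module ℂ W]

theorem pullback_bracket_eq_conj (φ : V ≃ₗ[ℂ] W) (ν : LieStructure W) (x : V) :
    (ν.pullback φ).bracket x = φ.symm.conj (ν.bracket (φ x)) := by
  ext y
  simp [pullback_bracket, LinearEquiv.conj_apply]

theorem adTrace_pullback (φ : V ≃ₗ[ℂ] W) (ν : LieStructure W) (x : V) :
    (ν.pullback φ).adTrace x = ν.adTrace (φ x) := by
  simp only [adTrace, LinearMap.comp_apply, pullback_bracket_eq_conj, LinearMap.trace_conj']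

theorem adTraceSq_pullback (φ : V ≃ₗ[ℂ] W) (ν : LieStructure W) (x : V) :
    (ν.pullback φ).adTraceSq x = ν.adTraceSq (φ x) := by
  simp only [adTraceSq, pullback_bracket_eq_conj, ← LinearEquiv.conj_comp, LinearMap.trace_conj']

end Pullback

section Limit

variable {V : Type*} [AddCommGroup V] [Module ℂ V] [TopologicalSpace V]
  [IsTopologicalAddGroup V] [ContinuousSMul ℂ V] [T2Space V]
  {ι : Type*} {l : Filter ι} {ν : ι → LieStructure V} {ν₀ : LieStructure V}

theorem tendsto_repr (b : Basis (Fin 3) ℂ V) {x : ι → V} {x₀ : V} (hx : Tendsto x l (𝓝 x₀))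
    (i : Fin 3) : Tendsto (fun k => b.repr (x k) i) l (𝓝 (b.repr x₀ i)) := by
  have : FiniteDimensional ℂ V := b.finiteDimensional_of_finite
  exact ((b.coord i).continuous_of_finiteDimensional.tendsto x₀).comp hx

/-- Expanding the moving argument in a finite basis reduces this to pointwise convergence of the
brackets. -/
theorem tendsto_bracket_right (b : Basis (Fin 3) ℂ V)
    (h : ∀ x y, Tendsto (fun k => (ν k).bracket x y) l (𝓝 (ν₀.bracket x y)))
    (x : V) {y : ι → V} {y₀ : V} (hy : Tendsto y l (𝓝 y₀)) :
    Tendsto (fun k => (ν k).bracket x (y k)) l (𝓝 (ν₀.bracket x y₀)) := by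
  have key : ∀ (μ : LieStructure V) (v : V),
      μ.bracket x v = ∑ i, b.repr v i • μ.bracket x (b i) := by
    intro μ v
    conv_lhs => rw [← b.sum_repr v, map_sum]
    simp
  simp only [key _ (y _), key _ y₀]
  exact tendsto_finsetSum _ fun i _ => (tendsto_repr b hy i).smul (h x (b i))

theorem tendsto_bracket_left (b : Basis (Fin 3) ℂ V)
    (h : ∀ x y, Tendsto (fun k => (ν k).bracket x y) l (𝓝 (ν₀.bracket x y)))
    {x : ι → V} {x₀ : V} (hx : Tendsto x l (𝓝 x₀)) (y : V) :
    Tendsto (fun k => (ν k).bracket (x k) y) l (𝓝 (ν₀.bracket x₀ y)) := by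
  simp only [skew _ (x _) y, skew _ x₀ y]
  exact (tendsto_bracket_right b h y hx).neg

theorem tendsto_bracket_bracket (b : Basis (Fin 3) ℂ V)
    (h : ∀ x y, Tendsto (fun k => (ν k).bracket x y) l (𝓝 (ν₀.bracket x y)))
    {x y : ι → V} {x₀ y₀ : V} (hx : Tendsto x l (𝓝 x₀)) (hy : Tendsto y l (𝓝 y₀)) :
    Tendsto (fun k => (ν k).bracket (x k) (y k)) l (𝓝 (ν₀.bracket x₀ y₀)) := by
  have key : ∀ (μ : LieStructure V) (u v : V),
      μ.bracket u v = ∑ i, b.repr v i • μ.bracket u (b i) := by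
    intro μ u v
    conv_lhs => rw [← b.sum_repr v, map_sum]
    simp
  simp only [key _ (x _) (y _), key _ x₀ y₀]
  exact tendsto_finsetSum _ fun i _ => (tendsto_repr b hy i).smul (tendsto_bracket_left b h hx _)

theorem tendsto_adTrace (b : Basis (Fin 3) ℂ V)
    (h : ∀ x y, Tendsto (fun k => (ν k).bracket x y) l (𝓝 (ν₀.bracket x y))) (x : V) :
    Tendsto (fun k => (ν k).adTrace x) l (𝓝 (ν₀.adTrace x)) := by
  simp only [adTrace_eq_sum _ b]
  exact tendsto_finsetSum _ fun i _ => tendsto_repr b (h _ _) i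

theorem tendsto_adTraceSq (b : Basis (Fin 3) ℂ V)
    (h : ∀ x y, Tendsto (fun k => (ν k).bracket x y) l (𝓝 (ν₀.bracket x y))) (x : V) :
    Tendsto (fun k => (ν k).adTraceSq x) l (𝓝 (ν₀.adTraceSq x)) := by
  simp only [adTraceSq_eq_sum _ b]
  exact tendsto_finsetSum _ fun i _ => tendsto_repr b (tendsto_bracket_right b h _ (h _ _)) i

end Limit

section Contraction

variable {V : Type*} [AddCommGroup V] [Module ℂ V] [TopologicalSpace V]
  {μ μ₀ : LieStructure V}

/-- This form makes every algebra of the family isomorphic to the source, so its identities hold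
along the whole family and pass to the limit. -/
theorem ContractsTo.exists_tendsto (h : μ.ContractsTo μ₀) : ∃ U : ℝ → V ≃ₗ[ℂ] V, ∀ x y,
    Tendsto (fun ε => (μ.pullback (U ε)).bracket x y) (𝓝[>] 0) (𝓝 (μ₀.bracket x y)) := by
  obtain ⟨C, rfl, rfl⟩ := h
  exact ⟨C.U, C.tendsto_bracket⟩

theorem ContractsTo.bracket_eq_zero [T2Space V] (h : μ.ContractsTo μ₀) (hμ : ∀ x y, μ.bracket x y = 0)
    (x y : V) : μ₀.bracket x y = 0 := by
  obtain ⟨U, hU⟩ := h.exists_tendsto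
  refine tendsto_nhds_unique (hU x y) ?_
  simp [pullback_bracket, hμ]

variable [IsTopologicalAddGroup V] [ContinuousSMul ℂ V] [T2Space V]

theorem ContractsTo.bracket_bracket_eq_zero (h : μ.ContractsTo μ₀) (b : Basis (Fin 3) ℂ V)
    (hμ : ∀ x y z, μ.bracket x (μ.bracket y z) = 0) (x y z : V) :
    μ₀.bracket x (μ₀.bracket y z) = 0 := by
  obtain ⟨U, hU⟩ := h.exists_tendsto
  refine tendsto_nhds_unique (tendsto_bracket_right b hU x (hU y z)) ?_
  simp [pullback_bracket, hμ]

theorem ContractsTo.metabelian (h : μ.ContractsTo μ₀) (b : Basis (Fin 3) ℂ V)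
    (hμ : ∀ x y z w, μ.bracket (μ.bracket x y) (μ.bracket z w) = 0) (x y z w : V) :
    μ₀.bracket (μ₀.bracket x y) (μ₀.bracket z w) = 0 := by
  obtain ⟨U, hU⟩ := h.exists_tendsto
  refine tendsto_nhds_unique (tendsto_bracket_bracket b hU (hU x y) (hU z w)) ?_
  simp [pullback_bracket, hμ]

theorem ContractsTo.adTrace_eq_zero (h : μ.ContractsTo μ₀) (b : Basis (Fin 3) ℂ V)
    (hμ : ∀ x, μ.adTrace x = 0) (x : V) : μ₀.adTrace x = 0 := by
  obtain ⟨U, hU⟩ := h.exists_tendsto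
  refine tendsto_nhds_unique (tendsto_adTrace b hU x) ?_
  simp [adTrace_pullback, hμ]

/-- The identity expresses the bracket through its trace form; among the listed algebras only `g33`
and the Abelian one satisfy it. -/
theorem ContractsTo.two_smul_bracket (h : μ.ContractsTo μ₀) (b : Basis (Fin 3) ℂ V)
    (hμ : ∀ x y, (2 : ℂ) • μ.bracket x y = μ.adTrace x • y - μ.adTrace y • x) (x y : V) :
    (2 : ℂ) • μ₀.bracket x y = μ₀.adTrace x • y - μ₀.adTrace y • x := by
  obtain ⟨U, hU⟩ := h.exists_tendsto
  refine tendsto_nhds_unique ((hU x y).const_smul (2 : ℂ)) ?_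
  have := ((tendsto_adTrace b hU x).smul_const y).sub ((tendsto_adTrace b hU y).smul_const x)
  refine this.congr fun ε => ?_
  rw [pullback_bracket, ← map_smul, hμ, adTrace_pullback, adTrace_pullback]
  simp

theorem ContractsTo.adTraceSq_relation (h : μ.ContractsTo μ₀) (b : Basis (Fin 3) ℂ V) (r s : ℂ)
    (hμ : ∀ x, r * μ.adTrace x ^ 2 = s * μ.adTraceSq x) (x : V) :
    r * μ₀.adTrace x ^ 2 = s * μ₀.adTraceSq x := by
  obtain ⟨U, hU⟩ := h.exists_tendsto
  refine tendsto_nhds_unique (((tendsto_adTrace b hU x).pow 2).const_mul r) ?_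
  refine ((tendsto_adTraceSq b hU x).const_mul s).congr fun ε => ?_
  rw [adTrace_pullback, adTraceSq_pullback, hμ]

end Contraction

section Transfer

variable {V W : Type*} [AddCommGroup V] [Module ℂ V] [TopologicalSpace V]
  [IsTopologicalAddGroup V] [ContinuousSMul ℂ V] [T2Space V] [FiniteDimensional ℂ V]
  [AddCommGroup W] [Module ℂ W] [TopologicalSpace W]
  [IsTopologicalAddGroup W] [ContinuousSMul ℂ W]

/-- Replace U by φ U ψ⁻¹, with φ and ψ the isomorphisms of sources and of targets; linear maps from
a finite-dimensional space are continuous. -/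
theorem ContractsTo.congr {μ μ₀ : LieStructure V} {ν ν₀ : LieStructure W} (h : μ.ContractsTo μ₀)
    (e : μ.Isomorphic ν) (e₀ : μ₀.Isomorphic ν₀) : ν.ContractsTo ν₀ := by
  obtain ⟨C, rfl, rfl⟩ := h
  obtain ⟨φ, hφ⟩ := isomorphic_iff.1 e
  obtain ⟨ψ, hψ⟩ := isomorphic_iff.1 e₀
  have cφ := φ.toLinearMap.continuous_of_finiteDimensional
  have cψ := ψ.toLinearMap.continuous_of_finiteDimensional
  refine ⟨⟨ν, ν₀, fun ε => ψ.symm.trans ((C.U ε).trans φ), fun x => ?_, fun x y => ?_⟩, rfl, rfl⟩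
  · exact cφ.comp_continuousOn (C.continuousOn_U (ψ.symm x))
  · have h1 := (cψ.tendsto _).comp (C.tendsto_bracket (ψ.symm x) (ψ.symm y))
    simp only [LinearEquiv.coe_coe, hψ, LinearEquiv.apply_symm_apply] at h1
    refine h1.congr fun ε => ?_
    simp [← hφ]

theorem ContractsTo.of_isomorphic {μ μ₀ : LieStructure V} (h : μ.Isomorphic μ₀) :
    μ.ContractsTo μ₀ := by
  have : μ.ContractsTo μ :=
    ⟨⟨μ, μ, fun _ => LinearEquiv.refl ℂ V, fun x => continuousOn_const,
      fun x y => tendsto_const_nhds⟩, rfl, rfl⟩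
  exact this.congr (.refl μ) h

end Transfer

end LieStructure

/-! ### Obstructions to contractions between the listed algebras -/

namespace LieNode

/-- The paths of the contraction diagram, up to the coincidences between nodes. -/
def Reaches (m n : LieNode) : Prop := m.Same n ∨ Relation.TransGen Arrow m n

theorem adTrace_algebra (n : LieNode) (x : Fin 3 → ℂ) : n.algebra.adTrace x =
    x 0 * (n.commutators.1 1 + n.commutators.2.1 2) +
      x 1 * (n.commutators.2.2 2 - n.commutators.1 0) -
      x 2 * (n.commutators.2.1 0 + n.commutators.2.2 1) := by
  rw [LieStructure.adTrace_eq_sum _ (Pi.basisFun ℂ (Fin 3)), Fin.sum_univ_three]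
  simp [bracket_algebra, bracketOfCommutators_apply]
  ring

theorem adTraceSq_algebra (n : LieNode) (x : Fin 3 → ℂ) : n.algebra.adTraceSq x =
    (x 1 * n.commutators.1 0 + x 2 * n.commutators.2.1 0) ^ 2 +
      (x 0 * n.commutators.1 1 - x 2 * n.commutators.2.2 1) ^ 2 +
      (x 0 * n.commutators.2.1 2 + x 1 * n.commutators.2.2 2) ^ 2 -
      2 * (x 0 * n.commutators.1 0 - x 2 * n.commutators.2.2 0) *
        (x 1 * n.commutators.1 1 + x 2 * n.commutators.2.1 1) -
      2 * (x 0 * n.commutators.2.1 0 + x 1 * n.commutators.2.2 0) *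
        (x 1 * n.commutators.1 2 + x 2 * n.commutators.2.1 2) +
      2 * (x 0 * n.commutators.2.1 1 + x 1 * n.commutators.2.2 1) *
        (x 0 * n.commutators.1 2 - x 2 * n.commutators.2.2 2) := by
  rw [LieStructure.adTraceSq_eq_sum _ (Pi.basisFun ℂ (Fin 3)), Fin.sum_univ_three]
  simp [bracket_algebra, bracketOfCommutators_apply]
  ring

end LieNode

namespace LieNode

open Relation

theorem reaches_abelian (m : LieNode) : m.Reaches abelian := by
  cases m with
  | abelian => exact .inl (.inl rfl)
  | g21_g1 => exact .inr (.tail (.single .g21_g1_g31) .g31_abelian)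
  | g31 => exact .inr (.single .g31_abelian)
  | g32 => exact .inr (.tail (.single .g32_g31) .g31_abelian)
  | g33 => exact .inr (.single .g33_abelian)
  | g34 α h0 h1 => exact .inr (.tail (.single (.g34_g31 α h0 h1)) .g31_abelian)
  | sl2 => exact .inr (.tail (.tail (.single (.sl2_g34 (by norm_num) (by norm_num)))
      (.g34_g31 _ _ _)) .g31_abelian)

/-- The algebras contained in the closure defined by the invariant `(tr ad)² : tr ad²`. -/
theorem of_adTraceSq_relation (n : LieNode) (α : ℂ)
    (h : ∀ x, (1 + α ^ 2) * n.algebra.adTrace x ^ 2 = (1 + α) ^ 2 * n.algebra.adTraceSq x) :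
    n = abelian ∨ n = g31 ∨ (α = 0 ∧ n = g21_g1) ∨ (α = 1 ∧ (n = g32 ∨ n = g33)) ∨
      (α = -1 ∧ n = sl2) ∨ ∃ β h0 h1, n = g34 β h0 h1 ∧ (α = β ∨ α * β = 1) := by
  -- Two test vectors suffice: e₂ for `g21_g1` and `sl2`, and e₃ for `g32`, `g33` and `g34`.
  have h2 := h (Pi.single 1 1)
  have h3 := h (Pi.single 2 1)
  rw [adTrace_algebra, adTraceSq_algebra] at h2 h3
  cases n <;> simp [commutators] at h2 h3
  · simp
  · simp only [reduceCtorEq, and_true, and_false, false_or, or_false, false_and, exists_false]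
    linear_combination (-1 / 2) * h2
  · simp
  · simp only [reduceCtorEq, and_true, and_false, false_or, or_false, false_and, exists_false]
    have : (α - 1) ^ 2 = 0 := by linear_combination (1 / 2) * h3
    exact sub_eq_zero.1 (pow_eq_zero_iff two_ne_zero |>.1 this)
  · simp only [reduceCtorEq, and_true, and_false, false_or, or_false, false_and, exists_false,
      or_true]
    have : (α - 1) ^ 2 = 0 := by linear_combination (1 / 2) * h3
    exact sub_eq_zero.1 (pow_eq_zero_iff two_ne_zero |>.1 this)
  · rename_i β h0 h1
    refine .inr (.inr (.inr (.inr (.inr ⟨β, h0, h1, rfl, ?_⟩))))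
    have : (α - β) * (α * β - 1) = 0 := by linear_combination (1 / 2) * h3
    rcases mul_eq_zero.1 this with h | h
    · exact .inl (sub_eq_zero.1 h)
    · exact .inr (sub_eq_zero.1 h)
  · simp only [reduceCtorEq, and_true, and_false, false_or, or_false, false_and, exists_false]
    linear_combination h2

/-- Only the pairs of nodes connected by a path of the diagram are related by a contraction. -/
theorem reaches_of_contractsTo {m n : LieNode} (h : m.algebra.ContractsTo n.algebra) :
    m.Reaches n := by
  have b := Pi.basisFun ℂ (Fin 3)
  cases m with
  | abelian =>
    have key := h.bracket_eq_zero fun x y => by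
      simp [bracket_algebra, commutators, bracketOfCommutators_apply]
    have h1 := congrFun (key (Pi.single 0 1) (Pi.single 1 1))
    have h2 := congrFun (key (Pi.single 1 1) (Pi.single 2 1))
    cases n <;>
      simp [bracket_algebra, commutators, bracketOfCommutators_apply, Fin.forall_fin_succ] at h1 h2
    · exact reaches_abelian _
    · contradiction
  | g31 =>
    have key := h.bracket_bracket_eq_zero b fun x y z => by
      ext i
      fin_cases i <;> simp [bracket_algebra, commutators, bracketOfCommutators_apply]
    have h1 := congrFun (key (Pi.single 1 1) (Pi.single 0 1) (Pi.single 1 1))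
    have h2 := congrFun (key (Pi.single 2 1) (Pi.single 0 1) (Pi.single 2 1))
    cases n <;>
      simp [bracket_algebra, commutators, bracketOfCommutators_apply, Fin.forall_fin_succ] at h1 h2
    · exact reaches_abelian _
    · exact .inl (.inl rfl)
  | g33 =>
    have key := h.two_smul_bracket b fun x y => by
      simp only [adTrace_algebra]
      ext i
      fin_cases i <;> simp [bracket_algebra, commutators, bracketOfCommutators_apply] <;> ring
    have h2 := congrFun (key (Pi.single 1 1) (Pi.single 2 1))
    cases n <;> simp [bracket_algebra, adTrace_algebra, commutators, bracketOfCommutators_apply,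
      Fin.forall_fin_succ] at h2
    · exact reaches_abelian _
    · exact .inl (.inl rfl)
    · rename_i β h0 h1
      exact absurd (by linear_combination h2) h1
  | g21_g1 =>
    -- This algebra behaves as eigenvalue ratio α = 0; `g32` below is the case α = 1.
    have key := h.adTraceSq_relation b (1 + 0 ^ 2) ((1 + 0) ^ 2) fun x => by
      simp only [adTrace_algebra, adTraceSq_algebra]
      simp [commutators]
    obtain rfl | rfl | ⟨-, rfl⟩ | ⟨h, -⟩ | ⟨h, -⟩ | ⟨β, h0, h1, rfl, hβ⟩ :=
      of_adTraceSq_relation n 0 key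
    · exact reaches_abelian _
    · exact .inr (.single .g21_g1_g31)
    · exact .inl (.inl rfl)
    · norm_num at h
    · norm_num at h
    · rcases hβ with hβ | hβ
      · exact absurd hβ.symm h0
      · norm_num at hβ
  | g32 =>
    have key := h.adTraceSq_relation b (1 + 1 ^ 2) ((1 + 1) ^ 2) fun x => by
      simp only [adTrace_algebra, adTraceSq_algebra]
      simp [commutators]
      ring
    obtain rfl | rfl | ⟨h, -⟩ | ⟨-, rfl | rfl⟩ | ⟨h, -⟩ | ⟨β, h0, h1, rfl, hβ⟩ :=
      of_adTraceSq_relation n 1 key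
    · exact reaches_abelian _
    · exact .inr (.single .g32_g31)
    · norm_num at h
    · exact .inl (.inl rfl)
    · exact .inr (.single .g32_g33)
    · norm_num at h
    · rw [one_mul] at hβ
      rcases hβ with hβ | hβ
      · exact absurd hβ.symm h1
      · exact absurd hβ h1
  | g34 α a0 a1 =>
    have key := h.adTraceSq_relation b (1 + α ^ 2) ((1 + α) ^ 2) fun x => by
      simp only [adTrace_algebra, adTraceSq_algebra]
      simp [commutators]
      ring
    obtain rfl | rfl | ⟨h, -⟩ | ⟨h, -⟩ | ⟨-, rfl⟩ | ⟨β, h0, h1, rfl, hβ⟩ :=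
      of_adTraceSq_relation n α key
    · exact reaches_abelian _
    · exact .inr (.single (.g34_g31 _ _ _))
    · exact absurd h a0
    · exact absurd h a1
    -- For α = -1 the trace relation only says tr ad = 0, which `sl2` also satisfies; solvability of
    -- the source excludes it.
    · have key := h.metabelian b fun x y z w => by
        ext i
        fin_cases i <;> simp [bracket_algebra, commutators, bracketOfCommutators_apply]
      have h1 := congrFun (key (Pi.single 0 1) (Pi.single 1 1) (Pi.single 0 1) (Pi.single 2 1)) 0
      simp [bracket_algebra, commutators, bracketOfCommutators_apply] at h1
    · rcases hβ with rfl | hβ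
      · exact .inl (.inl rfl)
      · exact .inl (.inr ⟨α, β, a0, a1, h0, h1, rfl, rfl, hβ⟩)
  | sl2 =>
    -- Every listed algebra with tr ad = 0 is reached from `sl2`, so this one condition is enough.
    have key := h.adTrace_eq_zero b fun x => by simp [adTrace_algebra, commutators]
    have h1 := key (Pi.single 1 1)
    have h2 := key (Pi.single 2 1)
    cases n <;> simp [adTrace_algebra, commutators] at h1 h2
    · exact reaches_abelian _
    · exact .inr (.tail (.single (.sl2_g34 (by norm_num) (by norm_num))) (.g34_g31 _ _ _))
    · rename_i β h0 h1
      obtain rfl : β = -1 := by linear_combination -h2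
      exact .inr (.single (.sl2_g34 _ _))
    · exact .inl (.inl rfl)

end LieNode

/-! ### Levels, paths and coincidences in the diagram -/

namespace LieNode

open Relation

/-- The height of a node in the contraction diagram. -/
def level : LieNode → ℕ
  | abelian => 0
  | g31 => 1
  | g33 => 1
  | g21_g1 => 2
  | g32 => 2
  | g34 _ _ _ => 2
  | sl2 => 3

theorem Arrow.level_eq {m n : LieNode} (h : Arrow m n) : m.level = n.level + 1 := by
  cases h <;> rfl

theorem level_lt_of_transGen {m n : LieNode} (h : TransGen Arrow m n) : n.level < m.level := by
  induction h with
  | single h => exact h.level_eq ▸ Nat.lt_succ_self _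
  | tail _ h ih => have := h.level_eq; omega

theorem Same.level_eq {m n : LieNode} (h : m.Same n) : m.level = n.level := by
  rcases h with rfl | ⟨α, β, _, _, _, _, rfl, rfl, -⟩ <;> rfl

theorem Same.symm {m n : LieNode} (h : m.Same n) : n.Same m := by
  rcases h with rfl | ⟨α, β, a0, a1, b0, b1, rfl, rfl, h⟩
  · exact .inl rfl
  · exact .inr ⟨β, α, b0, b1, a0, a1, rfl, rfl, by rw [mul_comm, h]⟩

theorem Same.isomorphic {m n : LieNode} (h : m.Same n) : m.algebra.Isomorphic n.algebra := by
  rcases h with rfl | ⟨α, β, a0, a1, b0, b1, rfl, rfl, h⟩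
  · exact .refl _
  -- Swap the eigenvectors and multiply e₃ by β, so that the eigenvalues (1, α) become (αβ, β) = (1,
  -- β) in the new order.
  · obtain ⟨v, v0, v1, v2⟩ := exists_basis_of_three (Module.finrank_fin_fun ℂ (n := 3))
      (Pi.single 1 1) (Pi.single 0 1) (Pi.single 2 β) (by
        intro r s t h
        have h0 := congrFun h 0
        have h1 := congrFun h 1
        have h2 := congrFun h 2
        simp [b0] at h0 h1 h2
        exact ⟨h1, h0, h2⟩)
    refine isomorphic_algebra _ v ?_ ?_ ?_ <;> ext i <;> fin_cases i <;>
      simp [bracket_algebra, commutators, bracketOfCommutators_apply, Fin.sum_univ_three,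
        v0, v1, v2]
    linear_combination h

/-- An isomorphism yields contractions both ways, and paths in both directions would each strictly
lower the level. -/
theorem isomorphic_iff_same {m n : LieNode} : m.algebra.Isomorphic n.algebra ↔ m.Same n := by
  refine ⟨fun h => ?_, Same.isomorphic⟩
  rcases reaches_of_contractsTo (.of_isomorphic h) with h1 | h1
  · exact h1
  · rcases reaches_of_contractsTo (.of_isomorphic h.symm) with h2 | h2
    · exact h2.symm
    · have := level_lt_of_transGen h1
      have := level_lt_of_transGen h2
      omega

/-- Leaves few enough composite paths that each can be given its own simple contraction. -/
theorem eq_of_transGen {m n : LieNode} (h : TransGen Arrow m n) :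
    Arrow m n ∨ (m = sl2 ∧ n = g31) ∨ n = abelian := by
  induction h with
  | single h => exact .inl h
  | tail _ h ih =>
    cases h with
    | sl2_g34 =>
      rcases ih with ih | ⟨_, ih⟩ | ih
      · cases ih
      · cases ih
      · cases ih
    | g34_g31 =>
      rcases ih with ih | ⟨_, ih⟩ | ih
      · cases ih
        exact .inr (.inl ⟨rfl, rfl⟩)
      · cases ih
      · cases ih
    | g21_g1_g31 =>
      rcases ih with ih | ⟨_, ih⟩ | ih
      · cases ih
      · cases ih
      · cases ih
    | g32_g31 =>
      rcases ih with ih | ⟨_, ih⟩ | ih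
      · cases ih
      · cases ih
      · cases ih
    | g32_g33 =>
      rcases ih with ih | ⟨_, ih⟩ | ih
      · cases ih
      · cases ih
      · cases ih
    | g33_abelian => exact .inr (.inr rfl)
    | g31_abelian => exact .inr (.inr rfl)

end LieNode

/-! ### Construction of simple Inönü–Wigner contractions -/

theorem continuous_bracketOfCommutators {a b c : ℂ → Fin 3 → ℂ} (ha : Continuous a)
    (hb : Continuous b) (hc : Continuous c) (x y : Fin 3 → ℂ) :
    Continuous fun ε => bracketOfCommutators (a ε) (b ε) (c ε) x y := by
  simp only [bracketOfCommutators_apply]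
  fun_prop

section SimpleContractions

variable {V : Type*} [AddCommGroup V] [Module ℂ V] [TopologicalSpace V]
  [IsTopologicalAddGroup V] [ContinuousSMul ℂ V]

namespace LieNode

/-- The algebra at the node `m` has, in the basis formed by `ε ^ dᵢ • wᵢ` with `dᵢ ∈ {0, 1}`, the
commutators `a ε`, `b ε`, `c ε`, which tend to those of the algebra at the node `n`. -/
theorem exists_isSimpleInonuWigner (hV : finrank ℂ V = 3) (m n : LieNode)
    (w : Basis (Fin 3) ℂ (Fin 3 → ℂ)) (fixed : Fin 3 → Bool) (σ : Equiv.Perm (Fin 3)) (s : ℕ)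
    (hs : s ≤ 3) (hσ : ∀ i : Fin 3, fixed (σ i) = true ↔ (i : ℕ) < s) (a b c : ℂ → Fin 3 → ℂ)
    (ha : Continuous a) (hb : Continuous b) (hc : Continuous c)
    (h0 : (a 0, b 0, c 0) = n.commutators)
    (h : ∀ ε x y, ∑ i, ((if fixed i then 1 else ε) *
        bracketOfCommutators (a ε) (b ε) (c ε) x y i) • w i =
      m.algebra.bracket (∑ i, ((if fixed i then 1 else ε) * x i) • w i)
        (∑ i, ((if fixed i then 1 else ε) * y i) • w i)) :
    ∃ D : LieContraction V, D.IsSimpleInonuWigner ∧ D.source.Isomorphic m.algebra ∧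
      D.target.Isomorphic n.algebra := by
  have : FiniteDimensional ℂ V := FiniteDimensional.of_finrank_pos (by omega)
  let φ : V ≃ₗ[ℂ] (Fin 3 → ℂ) := LinearEquiv.ofFinrankEq _ _ (by simp [hV])
  have cφ : Continuous φ.symm := φ.symm.toLinearMap.continuous_of_finiteDimensional
  let u : ℝ → Fin 3 → ℂˣ := fun ε i =>
    if fixed i then 1 else if hε : (ε : ℂ) = 0 then 1 else Units.mk0 (ε : ℂ) hε
  have hu : ∀ ε : ℝ, ε ≠ 0 → ∀ i, (u ε i : ℂ) = if fixed i then 1 else (ε : ℂ) := by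
    intro ε hε i
    by_cases hi : fixed i = true <;> simp [u, hi, hε]
  let T : ℝ → (Fin 3 → ℂ) ≃ₗ[ℂ] (Fin 3 → ℂ) := fun ε =>
    (Pi.basisFun ℂ (Fin 3)).equiv (w.unitsSMul (u ε)) (Equiv.refl _)
  have hT : ∀ ε : ℝ, ε ≠ 0 → ∀ x, T ε x = ∑ i, ((if fixed i then 1 else (ε : ℂ)) * x i) • w i := by
    intro ε hε x
    rw [← (Pi.basisFun ℂ (Fin 3)).sum_repr x]
    simp only [map_sum, map_smul, T, Basis.equiv_apply, Equiv.refl_apply, Basis.unitsSMul_apply,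
      Units.smul_def, hu ε hε, smul_smul]
    simp [Pi.single_apply, mul_comm]
  let U : ℝ → V ≃ₗ[ℂ] V := fun ε => φ.trans ((T ε).trans φ.symm)
  have hcont : ∀ x, ContinuousOn (fun ε => U ε x) (Set.Ioc 0 1) := by
    intro x
    have : Continuous fun ε : ℝ =>
        φ.symm (∑ i, ((if fixed i then 1 else (ε : ℂ)) * φ x i) • w i) := by
      refine cφ.comp (continuous_finsetSum _ fun i _ => ?_)
      by_cases hi : fixed i = true
      · simp only [hi, if_true]
        fun_prop
      · simp only [hi, Bool.false_eq_true, if_false]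
        fun_prop
    refine this.continuousOn.congr fun ε hε => ?_
    simp [U, hT ε hε.1.ne']
  have htends : ∀ x y, Tendsto
      (fun ε => (U ε).symm ((m.algebra.pullback φ).bracket (U ε x) (U ε y))) (𝓝[>] 0)
      (𝓝 ((n.algebra.pullback φ).bracket x y)) := by
    intro x y
    have hc' : Continuous fun ε : ℝ =>
        φ.symm (bracketOfCommutators (a ε) (b ε) (c ε) (φ x) (φ y)) :=
      cφ.comp ((continuous_bracketOfCommutators ha hb hc _ _).comp Complex.continuous_ofReal)
    have h1 := (hc'.tendsto 0).mono_left (nhdsWithin_le_nhds (s := Set.Ioi 0))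
    have h2 : (n.algebra.pullback φ).bracket x y = φ.symm
        (bracketOfCommutators (a (0 : ℝ)) (b (0 : ℝ)) (c (0 : ℝ)) (φ x) (φ y)) := by
      rw [LieStructure.pullback_bracket, bracket_algebra, ← h0, Complex.ofReal_zero]
    rw [h2]
    refine h1.congr' ?_
    filter_upwards [self_mem_nhdsWithin] with ε hε
    have h3 := h ε (φ x) (φ y)
    simp only [← hT ε (ne_of_gt hε)] at h3
    rw [LinearEquiv.eq_symm_apply, LieStructure.pullback_bracket]
    simp [U, h3]
  refine ⟨⟨m.algebra.pullback φ, n.algebra.pullback φ, U, hcont, htends⟩, ?_,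
    LieStructure.pullback_isomorphic _ _, LieStructure.pullback_isomorphic _ _⟩
  -- The permutation σ lists the s unscaled vectors first.
  refine ⟨((Pi.basisFun ℂ (Fin 3)).map φ.symm).reindex (σ.symm.trans (finCongr hV.symm)),
    (w.map φ.symm).reindex (σ.symm.trans (finCongr hV.symm)), s, hV ▸ hs, fun ε hε i => ?_⟩
  have h4 : T ε (Pi.basisFun ℂ (Fin 3) (σ (finCongr hV i))) = (u ε (σ (finCongr hV i)) : ℂ) •
      w (σ (finCongr hV i)) := by
    simp only [T, Basis.equiv_apply, Equiv.refl_apply, Basis.unitsSMul_apply, Units.smul_def]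
  rw [hu ε hε.1.ne'] at h4
  simp only [hσ] at h4
  simp only [Basis.reindex_apply, Basis.map_apply, U, LinearEquiv.trans_apply,
    LinearEquiv.apply_symm_apply, Equiv.symm_trans_apply, Equiv.symm_symm, finCongr_symm]
  erw [h4]
  rw [map_smul]
  rfl

end LieNode

end SimpleContractions

theorem continuous_vec_three {f g h : ℂ → ℂ} (hf : Continuous f) (hg : Continuous g)
    (hh : Continuous h) : Continuous fun ε => (![f ε, g ε, h ε] : Fin 3 → ℂ) :=
  continuous_pi fun i => by fin_cases i <;> assumption

section SimpleContractions

variable {V : Type*} [AddCommGroup V] [Module ℂ V] [TopologicalSpace V]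
  [IsTopologicalAddGroup V] [ContinuousSMul ℂ V]

namespace LieNode

open Relation

/-- Scaling all of V by ε multiplies the bracket by ε. -/
theorem exists_isSimpleInonuWigner_abelian (hV : finrank ℂ V = 3) (m : LieNode) :
    ∃ D : LieContraction V, D.IsSimpleInonuWigner ∧ D.source.Isomorphic m.algebra ∧
      D.target.Isomorphic abelian.algebra := by
  refine exists_isSimpleInonuWigner hV m abelian (Pi.basisFun ℂ (Fin 3)) (fun _ => false) 1 0
    (by norm_num) (by simp) (fun ε => ε • m.commutators.1) (fun ε => ε • m.commutators.2.1)
    (fun ε => ε • m.commutators.2.2) (by fun_prop) (by fun_prop) (by fun_prop)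
    (by simp [commutators]) fun ε x y => ?_
  ext i
  fin_cases i <;> simp [bracket_algebra, bracketOfCommutators_apply, Fin.sum_univ_three] <;> ring

theorem exists_isSimpleInonuWigner_self (hV : finrank ℂ V = 3) (m : LieNode) :
    ∃ D : LieContraction V, D.IsSimpleInonuWigner ∧ D.source.Isomorphic m.algebra ∧
      D.target.Isomorphic m.algebra := by
  refine exists_isSimpleInonuWigner hV m m (Pi.basisFun ℂ (Fin 3)) (fun _ => true) 1 3
    le_rfl (by simp) (fun _ => m.commutators.1) (fun _ => m.commutators.2.1)
    (fun _ => m.commutators.2.2) (by fun_prop) (by fun_prop) (by fun_prop) rfl fun ε x y => ?_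
  ext i
  fin_cases i <;> simp [bracket_algebra, bracketOfCommutators_apply, Fin.sum_univ_three] <;> ring

theorem exists_isSimpleInonuWigner_sl2_g31 (hV : finrank ℂ V = 3) :
    ∃ D : LieContraction V, D.IsSimpleInonuWigner ∧ D.source.Isomorphic sl2.algebra ∧
      D.target.Isomorphic g31.algebra := by
  -- The pattern for every contraction to `g31`: choose w₀ = [w₁, w₂] independent of w₁ and w₂ and
  -- leave only w₁ unscaled. Then [w₁, εw₂] = εw₀ persists while the other commutators tend to zero.
  obtain ⟨w, w0, w1, w2⟩ := exists_basis_of_three (Module.finrank_fin_fun ℂ (n := 3))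
    ![0, 2, 0] ![1, 0, 0] ![0, 0, 1] (by
      intro r s t h
      have h0 := congrFun h 0
      have h1 := congrFun h 1
      have h2 := congrFun h 2
      simp at h0 h1 h2
      exact ⟨h1, h0, h2⟩)
  refine exists_isSimpleInonuWigner hV _ _ w ![false, true, false] (Equiv.swap 0 1) 1
    (by norm_num) (by decide) (fun ε => ![0, -2 * ε, 0]) (fun ε => ![0, 0, 2 * ε])
    (fun _ => ![1, 0, 0]) (continuous_vec_three ?_ ?_ ?_) (continuous_vec_three ?_ ?_ ?_)
    (by fun_prop) (by simp [commutators]) fun ε x y => ?_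
  iterate 6 fun_prop
  ext i
  fin_cases i <;> simp [bracket_algebra, commutators, bracketOfCommutators_apply,
    Fin.sum_univ_three, w0, w1, w2] <;> ring

theorem exists_isSimpleInonuWigner_of_arrow (hV : finrank ℂ V = 3) {m n : LieNode}
    (h : Arrow m n) :
    ∃ D : LieContraction V, D.IsSimpleInonuWigner ∧ D.source.Isomorphic m.algebra ∧
      D.target.Isomorphic n.algebra := by
  cases h with
  | sl2_g34 a0 a1 =>
    -- The Cartan element e₂ stays fixed and acts on e₁, e₃ with opposite eigenvalues; the
    -- commutator of the scaled root vectors is of order ε².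
    obtain ⟨w, w0, w1, w2⟩ := exists_basis_of_three (Module.finrank_fin_fun ℂ (n := 3))
      ![1, 0, 0] ![0, 0, 1] ![0, 1, 0] (by
        intro r s t h
        have h0 := congrFun h 0
        have h1 := congrFun h 1
        have h2 := congrFun h 2
        simp at h0 h1 h2
        exact ⟨h0, h2, h1⟩)
    refine exists_isSimpleInonuWigner hV _ _ w ![false, false, true] (Equiv.swap 0 2) 1
      (by norm_num) (by decide) (fun ε => ![0, 0, 2 * ε ^ 2]) (fun _ => ![1, 0, 0])
      (fun _ => ![0, -1, 0]) (continuous_vec_three ?_ ?_ ?_) (by fun_prop)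
      (by fun_prop) (by simp [commutators]) fun ε x y => ?_
    iterate 3 fun_prop
    ext i
    fin_cases i <;> simp [bracket_algebra, commutators, bracketOfCommutators_apply,
      Fin.sum_univ_three, w0, w1, w2] <;> ring
  | g34_g31 α a0 a1 =>
    -- Here w₁ = e₁ + e₂ is cyclic for the action of e₃ because α ≠ 1; the coefficients α + 1 and -α
    -- below come from its characteristic polynomial.
    obtain ⟨w, w0, w1, w2⟩ := exists_basis_of_three (Module.finrank_fin_fun ℂ (n := 3))
      ![1, α, 0] ![1, 1, 0] ![0, 0, 1] (by
        intro r s t h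
        have h0 := congrFun h 0
        have h1 := congrFun h 1
        have h2 := congrFun h 2
        simp at h0 h1 h2
        have hr : r * (α - 1) = 0 := by linear_combination h1 - h0
        have hr : r = 0 := by simpa [sub_eq_zero, a1] using hr
        subst hr
        exact ⟨rfl, by simpa using h0, h2⟩)
    refine exists_isSimpleInonuWigner hV _ _ w ![false, true, false] (Equiv.swap 0 1) 1
      (by norm_num) (by decide) (fun _ => 0) (fun ε => ![(α + 1) * ε, -α * ε ^ 2, 0])
      (fun _ => ![1, 0, 0]) (by fun_prop) (continuous_vec_three ?_ ?_ ?_)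
      (by fun_prop) (by simp [commutators]) fun ε x y => ?_
    iterate 3 fun_prop
    ext i
    fin_cases i <;> simp [bracket_algebra, commutators, bracketOfCommutators_apply,
      Fin.sum_univ_three, w0, w1, w2] <;> ring
  | g21_g1_g31 =>
    obtain ⟨w, w0, w1, w2⟩ := exists_basis_of_three (Module.finrank_fin_fun ℂ (n := 3))
      ![1, 0, 0] ![1, 0, 1] ![0, 1, 0] (by
        intro r s t h
        have h0 := congrFun h 0
        have h1 := congrFun h 1
        have h2 := congrFun h 2
        simp at h0 h1 h2
        subst h2
        exact ⟨by simpa using h0, rfl, h1⟩)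
    refine exists_isSimpleInonuWigner hV _ _ w ![false, true, false] (Equiv.swap 0 1) 1
      (by norm_num) (by decide) (fun _ => 0) (fun ε => ![ε, 0, 0])
      (fun _ => ![1, 0, 0]) (by fun_prop) (continuous_vec_three ?_ ?_ ?_)
      (by fun_prop) (by simp [commutators]) fun ε x y => ?_
    iterate 3 fun_prop
    ext i
    fin_cases i <;> simp [bracket_algebra, commutators, bracketOfCommutators_apply,
      Fin.sum_univ_three, w0, w1, w2]
    ring
  | g32_g31 =>
    obtain ⟨w, w0, w1, w2⟩ := exists_basis_of_three (Module.finrank_fin_fun ℂ (n := 3))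
      ![1, 1, 0] ![0, 1, 0] ![0, 0, 1] (by
        intro r s t h
        have h0 := congrFun h 0
        have h1 := congrFun h 1
        have h2 := congrFun h 2
        simp at h0 h1 h2
        subst h0
        exact ⟨rfl, by simpa using h1, h2⟩)
    refine exists_isSimpleInonuWigner hV _ _ w ![false, true, false] (Equiv.swap 0 1) 1
      (by norm_num) (by decide) (fun _ => 0) (fun ε => ![2 * ε, -ε ^ 2, 0])
      (fun _ => ![1, 0, 0]) (by fun_prop) (continuous_vec_three ?_ ?_ ?_)
      (by fun_prop) (by simp [commutators]) fun ε x y => ?_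
    iterate 3 fun_prop
    ext i
    fin_cases i <;> simp [bracket_algebra, commutators, bracketOfCommutators_apply,
      Fin.sum_univ_three, w0, w1, w2] <;> ring
  | g32_g33 =>
    -- Scaling e₂ alone multiplies the off-diagonal entry of the Jordan block by ε.
    refine exists_isSimpleInonuWigner hV _ _ (Pi.basisFun ℂ (Fin 3)) ![true, false, true]
      (Equiv.swap 1 2) 2
      (by norm_num) (by decide) (fun _ => 0) (fun _ => ![1, 0, 0])
      (fun ε => ![ε, 1, 0]) (by fun_prop) (by fun_prop) (continuous_vec_three ?_ ?_ ?_)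
      (by simp [commutators]) fun ε x y => ?_
    iterate 3 fun_prop
    ext i
    fin_cases i <;> simp [bracket_algebra, commutators, bracketOfCommutators_apply,
      Fin.sum_univ_three] <;> ring
  | g33_abelian => exact exists_isSimpleInonuWigner_abelian hV _
  | g31_abelian => exact exists_isSimpleInonuWigner_abelian hV _

/-- Contractions along the paths of the diagram are realized by simple Inönü–Wigner contractions. -/
theorem Reaches.exists_isSimpleInonuWigner (hV : finrank ℂ V = 3) {m n : LieNode}
    (h : m.Reaches n) :
    ∃ D : LieContraction V, D.IsSimpleInonuWigner ∧ D.source.Isomorphic m.algebra ∧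
      D.target.Isomorphic n.algebra := by
  rcases h with h | h
  · obtain ⟨D, hD, h1, h2⟩ := exists_isSimpleInonuWigner_self (V := V) hV m
    exact ⟨D, hD, h1, h2.trans h.isomorphic⟩
  · rcases eq_of_transGen h with h | ⟨rfl, rfl⟩ | rfl
    · exact exists_isSimpleInonuWigner_of_arrow hV h
    · exact exists_isSimpleInonuWigner_sl2_g31 hV
    · exact exists_isSimpleInonuWigner_abelian hV m

end LieNode

end SimpleContractions

/-! ### Contractions as paths, and the main theorem -/

namespace LieStructure

open Relation

theorem isomorphic_iff_same {V W : Type*} [AddCommGroup V] [Module ℂ V] [AddCommGroup W] [Module ℂ W] {μ : LieStructure V}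
    {μ₀ : LieStructure W} {m n : LieNode}
    (hμ : μ.Isomorphic m.algebra) (hμ₀ : μ₀.Isomorphic n.algebra) :
    μ.Isomorphic μ₀ ↔ m.Same n := by
  rw [← LieNode.isomorphic_iff_same]
  exact ⟨fun h => (hμ.symm.trans h).trans hμ₀, fun h => (hμ.trans h).trans hμ₀.symm⟩

variable {V : Type*} [AddCommGroup V] [Module ℂ V] [TopologicalSpace V]
  [IsTopologicalAddGroup V] [ContinuousSMul ℂ V] [T2Space V]
  {μ μ₀ : LieStructure V} {m n : LieNode}

theorem contractsTo_iff_reaches (hV : finrank ℂ V = 3) (hμ : μ.Isomorphic m.algebra)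
    (hμ₀ : μ₀.Isomorphic n.algebra) : μ.ContractsTo μ₀ ↔ m.Reaches n := by
  have : FiniteDimensional ℂ V := FiniteDimensional.of_finrank_pos (by omega)
  refine ⟨fun h => LieNode.reaches_of_contractsTo (h.congr hμ hμ₀), fun h => ?_⟩
  obtain ⟨D, -, h1, h2⟩ := h.exists_isSimpleInonuWigner (V := V) hV
  have hD : D.source.ContractsTo D.target := ⟨D, rfl, rfl⟩
  exact hD.congr (h1.trans hμ.symm) (h2.trans hμ₀.symm)

theorem properlyContractsTo_iff_transGen (hV : finrank ℂ V = 3) (hμ : μ.Isomorphic m.algebra)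
    (hμ₀ : μ₀.Isomorphic n.algebra) :
    μ.ProperlyContractsTo μ₀ ↔ TransGen LieNode.Arrow m n := by
  rw [ProperlyContractsTo, contractsTo_iff_reaches hV hμ hμ₀, isomorphic_iff_same hμ₀ hμ]
  constructor
  · rintro ⟨h | h, h'⟩
    · exact absurd h.symm h'
    · exact h
  · intro h
    refine ⟨.inr h, fun h' => ?_⟩
    have := LieNode.level_lt_of_transGen h
    have := h'.level_eq
    omega

/-- An arrow lowers the level by exactly one, which leaves no room for an intermediate algebra; a
longer path provides one, namely the end of its first arrow. -/
theorem directlyContractsTo_iff_arrow (hV : finrank ℂ V = 3) (hμ : μ.Isomorphic m.algebra)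
    (hμ₀ : μ₀.Isomorphic n.algebra) : μ.DirectlyContractsTo μ₀ ↔ LieNode.Arrow m n := by
  rw [DirectlyContractsTo, properlyContractsTo_iff_transGen hV hμ hμ₀]
  constructor
  · rintro ⟨h, hd⟩
    obtain ⟨k, hmk, hkn⟩ := TransGen.head'_iff.1 h
    rcases reflTransGen_iff_eq_or_transGen.1 hkn with rfl | hkn
    · exact hmk
    · refine absurd ?_ hd
      have hV' : finrank ℂ V = finrank ℂ (Fin 3 → ℂ) := by rw [hV, Module.finrank_fin_fun]
      have : FiniteDimensional ℂ V := FiniteDimensional.of_finrank_pos (by omega)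
      have hk := pullback_isomorphic (LinearEquiv.ofFinrankEq V (Fin 3 → ℂ) hV') k.algebra
      have h1 := (properlyContractsTo_iff_transGen hV hμ hk).2 (.single hmk)
      have h2 := (properlyContractsTo_iff_transGen hV hk hμ₀).2 hkn
      exact ⟨_, h1.2, fun h => h2.2 h.symm, h1.1, h2.1⟩
  · refine fun h => ⟨.single h, ?_⟩
    rintro ⟨μ₁, h1, h2, h3, h4⟩
    obtain ⟨k, hk⟩ := μ₁.exists_isomorphic_algebra hV
    have h5 := LieNode.level_lt_of_transGen ((properlyContractsTo_iff_transGen hV hμ hk).1 ⟨h3, h1⟩)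
    have h6 := LieNode.level_lt_of_transGen
      ((properlyContractsTo_iff_transGen hV hk hμ₀).1 ⟨h4, fun h => h2 h.symm⟩)
    have := h.level_eq
    omega

end LieStructure

theorem mainTheorem4 {V : Type*} [AddCommGroup V] [Module ℂ V] [TopologicalSpace V]
    [IsTopologicalAddGroup V] [ContinuousSMul ℂ V] [T2Space V]
    (hV : Module.finrank ℂ V = 3) :
    -- every contraction is equivalent to a simple Inönü–Wigner contraction
    (∀ C : LieContraction V, ∃ D : LieContraction V, D.IsSimpleInonuWigner ∧ C.Equivalent D) ∧
    -- the nodes of the diagram are all the algebras up to isomorphism, without repetition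
    (∀ μ : LieStructure V, ∃ n : LieNode, μ.Isomorphic n.algebra) ∧
    (∀ m n : LieNode, m.algebra.Isomorphic n.algebra ↔ m.Same n) ∧
    -- the arrows of the diagram are all the direct proper contractions
    (∀ (μ μ₀ : LieStructure V) (m n : LieNode),
      μ.Isomorphic m.algebra → μ₀.Isomorphic n.algebra →
        (μ.DirectlyContractsTo μ₀ ↔ LieNode.Arrow m n)) ∧
    -- the proper contractions are given by the directed paths of the diagram
    (∀ (μ μ₀ : LieStructure V) (m n : LieNode),
      μ.Isomorphic m.algebra → μ₀.Isomorphic n.algebra →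
        (μ.ProperlyContractsTo μ₀ ↔ Relation.TransGen LieNode.Arrow m n)) := by
  have exists_node (μ : LieStructure V) : ∃ n : LieNode, μ.Isomorphic n.algebra :=
    μ.exists_isomorphic_algebra hV
  refine ⟨fun C => ?_, exists_node, fun m n => LieNode.isomorphic_iff_same,
    fun μ μ₀ m n hμ hμ₀ => LieStructure.directlyContractsTo_iff_arrow hV hμ hμ₀,
    fun μ μ₀ m n hμ hμ₀ => LieStructure.properlyContractsTo_iff_transGen hV hμ hμ₀⟩
  obtain ⟨m, hm⟩ := exists_node C.source
  obtain ⟨n, hn⟩ := exists_node C.target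
  have h := (LieStructure.contractsTo_iff_reaches hV hm hn).1 ⟨C, rfl, rfl⟩
  obtain ⟨D, hD, h1, h2⟩ := h.exists_isSimpleInonuWigner (V := V) hV
  exact ⟨D, hD, hm.trans h1.symm, hn.trans h2.symm⟩
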